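/- Let $(R,\mathfrak m)$ be a Noetherian local ring and let $I$ be an $\mathfrak m$-primary ideal of $R$ which is a Burch ideal, that is, $\mathfrak m I\neq \mathfrak m(I:_R\mathfrak m)$. Then the local ring $A=R/I$ has only trivial semidualizing modules. That is, $A$ has a canonical module, and for every canonical module $K$ of $A$, each semidualizing $A$-module $C$ satisfies $C\cong A$ or $C\cong K$. Here a finitely generated $A$-module $C$ is semidualizing if the homothety map $A\to \operatorname{Hom}_A(C,C)$, $a\mapsto (c\mapsto ac)$, is an isomorphism and $\operatorname{Ext}^i_A(C,C)=0$ for all $i>0$. A canonical module of $A$ is a finitely generated $A$-module $K$ such that, with $k$ the residue field of $A$, $\operatorname{Ext}^i_A(k,K)\cong k$ for $i=\dim A$ and $\operatorname{Ext}^i_A(k,K)=0$ for $i\neq \dim A$. -/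

import Mathlib

open CategoryTheory

universe u

/-- A module `C` over a commutative ring `A` is semidualizing if it is finitely generated, the
homothety map `A → Hom_A(C, C)`, `a ↦ (c ↦ a • c)`, is bijective (it is always `A`-linear), and
`Ext^i_A(C, C) = 0` for all `i > 0`. -/
structure IsSemidualizing (A : Type u) [CommRing A] (C : Type u) [AddCommGroup C] [Module A C] :
    Prop where
  finite : Module.Finite A C
  bijective_homothety : Function.Bijective (LinearMap.lsmul A C : A → (C →ₗ[A] C))
  subsingleton_ext : ∀ i : ℕ, 0 < i →
    Subsingleton (Abelian.Ext (ModuleCat.of A C) (ModuleCat.of A C) i)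

/-- A finitely generated module `K` over a (Noetherian) local ring `A` with residue field `k` is a
canonical module if `Ext^i_A(k, K)` is one-dimensional over `k` (that is, isomorphic to `k`) for
`i = dim A` and zero for `i ≠ dim A`. In terms of Bass numbers: `μ_i(𝔪, K) = δ_{i, dim A}`. Over a
Cohen-Macaulay local ring this means that `K` is maximal Cohen-Macaulay, of type one and of finite
injective dimension. -/
structure IsCanonicalModule (A : Type u) [CommRing A] [IsLocalRing A]
    (K : Type u) [AddCommGroup K] [Module A K] : Prop where
  finite : Module.Finite A K
  nonempty_ext_equiv : ∀ i : ℕ, (i : WithBot ℕ∞) = ringKrullDim A →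
    Nonempty (Abelian.Ext (ModuleCat.of A (IsLocalRing.ResidueField A)) (ModuleCat.of A K) i
      ≃ₗ[A] IsLocalRing.ResidueField A)
  subsingleton_ext : ∀ i : ℕ, (i : WithBot ℕ∞) ≠ ringKrullDim A →
    Subsingleton
      (Abelian.Ext (ModuleCat.of A (IsLocalRing.ResidueField A)) (ModuleCat.of A K) i)

/-- The local ring `A` has a canonical module, and whenever `K` is a canonical module of `A`, each
semidualizing `A`-module is isomorphic to `A` or to `K`. -/
def HasOnlyTrivialSemidualizingModules (A : Type u) [CommRing A] [IsLocalRing A] : Prop :=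
  (∃ (K : Type u) (_ : AddCommGroup K) (_ : Module A K), IsCanonicalModule A K) ∧
  ∀ (K : Type u) [AddCommGroup K] [Module A K], IsCanonicalModule A K →
    ∀ (C : Type u) [AddCommGroup C] [Module A C], IsSemidualizing A C →
      Nonempty (C ≃ₗ[A] A) ∨ Nonempty (C ≃ₗ[A] K)

/-- An ideal `I` of a local ring `(R, 𝔪)` is a Burch ideal if `𝔪 I ≠ 𝔪 (I :_R 𝔪)`. -/
def IsBurchIdeal {R : Type u} [CommRing R] [IsLocalRing R] (I : Ideal R) : Prop :=
  IsLocalRing.maximalIdeal R * I ≠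
    IsLocalRing.maximalIdeal R * I.colon (IsLocalRing.maximalIdeal R : Set R)

/-!
Write `A = R / I`, an Artinian local ring, and let `k` be its residue field. The Burch condition
provides `a ∈ 𝔪` and `b ∈ I : 𝔪` with `a b ∉ 𝔪 I`; the class of `b` in `A` is killed by `𝔪`.

Let `M ≠ 0` be a finitely generated `A`-module with `b M = 0`, with a free cover `F₀ → M` that is
minimal, and let `d : F₁ → F₀` be a free cover of its syzygy. For a basis element `e` of `F₀` the
vector `b e` lies in the syzygy, say `b e = d g`. Then `𝔪 g ⊆ ker d`, and `a g` is a minimal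
generator of `ker d` (`smul_notMem_smul_ker`): lifting `d` to a matrix `D` over `R`, the vector
`D (a g)` is congruent to `a b e` modulo `𝔪 I`, whereas elements of `𝔪 (ker d)` lift to vectors
which `D` sends into `𝔪 I`.

Now suppose that `Ext^i(M, N) = 0` for all `i > 0`, and let a class in `Ext^1(k, N)` be given as the
element `q` of `Q / N` killed by `𝔪`, where `Q` is an injective module containing `N`. A map
`ker d → Q / N` with `a g ↦ q` lifts to `ψ : ker d → Q` because `Ext^1(ker d, N) = 0`. The map `a ψ`
has values in `N`, so it extends to `θ : F₁ → N` because `Ext^1(F₁ / ker d, N) = 0`. For `r ∈ 𝔪` one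
has `r ψ(a g) = a ψ(r g) = r θ(g)`, so `ψ(a g) - θ(g)` is a lift of `q` killed by `𝔪`, and the class
is zero (`exists_eq_smul_of_extension_of_lift`, `exists_eq_smul_of_subsingleton_ext`).

If `C` is semidualizing and not free, this applies to the first syzygy `M` of `C` and to `N = C`.
Hence `Ext^1(k, C) = 0`, and `C` is injective since `A` is Artinian
(`injective_of_forall_exists_eq_smul`). A canonical module `K` is an injective module with simple
socle; it embeds into `C` as a direct summand, and the endomorphism ring `A` of `C` is local, so
`C ≅ K` (`nonempty_linearEquiv_of_injective`). If `C` is free then it has rank one. Finally, the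
injective hull of `k` is a canonical module (`exists_injective_isSimpleSocleGenerator`).
-/

open IsLocalRing

/-! ### Consequences of the vanishing of `Ext` -/

section Ext

variable {A : Type u} [CommRing A]

/-- If `Ext^1(M, N) = 0` and `M = F / L`, then every linear map `L → N` extends to `F`. -/
theorem exists_extension_of_subsingleton_ext_one {F M N : Type u} [AddCommGroup F] [Module A F]
    [AddCommGroup M] [Module A M] [AddCommGroup N] [Module A N] (p : F →ₗ[A] M)
    (hp : Function.Surjective p)
    (h : Subsingleton (Abelian.Ext (ModuleCat.of A M) (ModuleCat.of A N) 1))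
    (f : LinearMap.ker p →ₗ[A] N) : ∃ g : F →ₗ[A] N, ∀ x : LinearMap.ker p, g x = f x := by
  have hS := LinearMap.shortExact_shortComplexKer hp
  obtain ⟨x, hx⟩ := Abelian.Ext.contravariant_sequence_exact₁ hS (Y := ModuleCat.of A N)
    (n₀ := 0) (n₁ := 1) (Abelian.Ext.mk₀ (ModuleCat.ofHom f)) rfl
    (@Subsingleton.elim _ h _ _)
  obtain ⟨g, rfl⟩ := Abelian.Ext.addEquiv₀.symm.surjective x
  refine ⟨g.hom, fun y => ?_⟩
  rw [Abelian.Ext.addEquiv₀_symm_apply, Abelian.Ext.mk₀_comp_mk₀] at hx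
  exact congr($(Abelian.Ext.addEquiv₀.symm.injective hx) y)

/-- If `Ext^1(M, N) = 0` and `N ⊆ Q`, then every linear map `M → Q / N` lifts to `Q`. -/
theorem exists_lift_of_subsingleton_ext_one {M N Q P : Type u} [AddCommGroup M] [Module A M]
    [AddCommGroup N] [Module A N] [AddCommGroup Q] [Module A Q] [AddCommGroup P] [Module A P]
    (i : N →ₗ[A] Q) (p : Q →ₗ[A] P) (hi : Function.Injective i) (hp : Function.Surjective p)
    (hip : Function.Exact i p)
    (h : Subsingleton (Abelian.Ext (ModuleCat.of A M) (ModuleCat.of A N) 1))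
    (f : M →ₗ[A] P) : ∃ g : M →ₗ[A] Q, p ∘ₗ g = f := by
  let S : ShortComplex (ModuleCat.{u} A) :=
    ⟨ModuleCat.ofHom i, ModuleCat.ofHom p, by
      rw [← ModuleCat.ofHom_comp, hip.linearMap_comp_eq_zero]; rfl⟩
  have hS : S.ShortExact := ModuleCat.shortComplex_shortExact S hip hi hp
  obtain ⟨x, hx⟩ := Abelian.Ext.covariant_sequence_exact₃ (ModuleCat.of A M) hS
    (n₀ := 0) (n₁ := 1) (Abelian.Ext.mk₀ (ModuleCat.ofHom f)) rfl
    (@Subsingleton.elim _ h _ _)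
  obtain ⟨g, rfl⟩ := Abelian.Ext.addEquiv₀.symm.surjective x
  refine ⟨g.hom, ?_⟩
  rw [Abelian.Ext.addEquiv₀_symm_apply, Abelian.Ext.mk₀_comp_mk₀] at hx
  exact congr($(Abelian.Ext.addEquiv₀.symm.injective hx).hom)

/-- Dimension shifting: the syzygy of `M` inherits the vanishing of `Ext^i(M, N)` for `i > 0`. -/
theorem subsingleton_ext_ker {F M N : Type u} [AddCommGroup F] [Module A F] [Module.Projective A F]
    [AddCommGroup M] [Module A M] [AddCommGroup N] [Module A N] (p : F →ₗ[A] M)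
    (hp : Function.Surjective p)
    (h : ∀ i : ℕ, 0 < i → Subsingleton (Abelian.Ext (ModuleCat.of A M) (ModuleCat.of A N) i))
    (i : ℕ) (hi : 0 < i) :
    Subsingleton (Abelian.Ext (ModuleCat.of A (LinearMap.ker p)) (ModuleCat.of A N) i) := by
  have hS := LinearMap.shortExact_shortComplexKer hp
  obtain ⟨n, rfl⟩ : ∃ n, i = n + 1 := ⟨i - 1, by lia⟩
  have hF : Projective (ModuleCat.of A F) := (IsProjective.iff_projective F).mp inferInstance
  have key : ∀ x : Abelian.Ext (ModuleCat.of A (LinearMap.ker p)) (ModuleCat.of A N) (n + 1),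
      x = 0 := by
    intro x
    have hsub := h (1 + (n + 1)) (by lia)
    obtain ⟨y, rfl⟩ := Abelian.Ext.contravariant_sequence_exact₁ hS (Y := ModuleCat.of A N) x rfl
      (@Subsingleton.elim _ hsub _ _)
    have hy : y = 0 := Abelian.Ext.eq_zero_of_projective (P := ModuleCat.of A F) y
    rw [hy, Abelian.Ext.comp_zero]
  exact subsingleton_of_forall_eq 0 key

end Ext

/-! ### Syzygies over the quotient by a Burch ideal -/

/-- A finitely generated module over a local ring has a minimal free cover. -/
theorem exists_minimal_free_cover {A : Type u} [CommRing A] [IsLocalRing A] (M : Type u)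
    [AddCommGroup M] [Module A M] [Module.Finite A M] :
    ∃ (n : ℕ) (p : (Fin n → A) →ₗ[A] M), Function.Surjective p ∧
      ∀ v ∈ LinearMap.ker p, ∀ i, v i ∈ maximalIdeal A := by
  classical
  have hex : ∃ (n : ℕ) (p : (Fin n → A) →ₗ[A] M), Function.Surjective p :=
    Module.Finite.exists_fin' A M
  obtain ⟨p, hp⟩ := Nat.find_spec hex
  refine ⟨Nat.find hex, p, hp, fun v hv j => ?_⟩
  by_contra hj
  have hu : IsUnit (v j) := by simpa using hj
  -- A relation with a unit coefficient expresses one of the generators through the others.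
  let f : {i : Fin (Nat.find hex) // i ≠ j} → M := fun i => p (Pi.single i 1)
  have hsum : ∀ w : Fin (Nat.find hex) → A, p w = w j • p (Pi.single j 1) +
      ∑ i : {i : Fin (Nat.find hex) // i ≠ j}, w i • f i := by
    intro w
    conv_lhs => rw [pi_eq_sum_univ' w, map_sum]
    simp only [map_smul]
    rw [← Fintype.sum_subtype_add_sum_subtype (· = j)]
    have hj' : ((default : {i : Fin (Nat.find hex) // i = j}) : Fin (Nat.find hex)) = j :=
      (default : {i : Fin (Nat.find hex) // i = j}).2
    simp [f, hj']
  have hmem : ∀ w : Fin (Nat.find hex) → A,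
      ∑ i : {i : Fin (Nat.find hex) // i ≠ j}, w i • f i ∈ Submodule.span A (Set.range f) :=
    fun w => Submodule.sum_mem _ fun i _ =>
      Submodule.smul_mem _ _ (Submodule.subset_span ⟨i, rfl⟩)
  have hjmem : p (Pi.single j 1) ∈ Submodule.span A (Set.range f) := by
    have h0 := hsum v
    rw [LinearMap.mem_ker.mp hv] at h0
    have h1 : v j • p (Pi.single j 1) ∈ Submodule.span A (Set.range f) := by
      rw [eq_neg_of_add_eq_zero_left h0.symm]
      exact neg_mem (hmem v)
    exact (Submodule.smul_mem_iff_of_isUnit _ hu).mp h1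
  have htop : ∀ m : M, m ∈ Submodule.span A (Set.range f) := by
    intro m
    obtain ⟨w, rfl⟩ := hp m
    rw [hsum w]
    exact add_mem (Submodule.smul_mem _ _ hjmem) (hmem w)
  have hcard : Fintype.card {i : Fin (Nat.find hex) // i ≠ j} < Nat.find hex := by
    have := Fintype.card_subtype_lt (p := fun i : Fin (Nat.find hex) => i ≠ j) (x := j) (by simp)
    simpa using this
  refine Nat.find_min hex hcard
    ⟨Fintype.linearCombination A (f ∘ (Fintype.equivFin _).symm), fun m => ?_⟩
  rw [← LinearMap.mem_range, Fintype.range_linearCombination,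
    (Fintype.equivFin _).symm.surjective.range_comp]
  exact htop m

/-- An element of `M` outside `𝔪 M` can be sent to any prescribed element killed by `𝔪`. -/
theorem exists_linearMap_of_notMem_smul_top {A : Type u} [CommRing A] [IsLocalRing A]
    {M P : Type*} [AddCommGroup M] [Module A M] [AddCommGroup P] [Module A P] (x : M)
    (hx : x ∉ maximalIdeal A • (⊤ : Submodule A M)) (y : P)
    (hy : ∀ r ∈ maximalIdeal A, r • y = 0) :
    ∃ f : M →ₗ[A] P, f x = y ∧ ∀ z, f z ∈ Submodule.span A {y} := by
  let _ : Field (A ⧸ maximalIdeal A) := Ideal.Quotient.field _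
  let V := M ⧸ maximalIdeal A • (⊤ : Submodule A M)
  have hv : (Submodule.Quotient.mk x : V) ≠ 0 := by
    rwa [Ne, Submodule.Quotient.mk_eq_zero]
  obtain ⟨φ, hφ⟩ : ∃ φ : Module.Dual (A ⧸ maximalIdeal A) V, φ (Submodule.Quotient.mk x) ≠ 0 := by
    by_contra! h
    exact hv ((Module.forall_dual_apply_eq_zero_iff (A ⧸ maximalIdeal A) _).mp h)
  let s : (A ⧸ maximalIdeal A) →ₗ[A] P :=
    Submodule.liftQ (maximalIdeal A) (LinearMap.toSpanSingleton A P y)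
      fun r hr => by simpa using hy r hr
  refine ⟨s ∘ₗ (((φ (Submodule.Quotient.mk x))⁻¹ • φ).restrictScalars A) ∘ₗ Submodule.mkQ _, ?_,
    fun z => ?_⟩
  · have h1 : ((φ (Submodule.Quotient.mk x))⁻¹ • φ) (Submodule.Quotient.mk x) = 1 := by
      simp [hφ]
    change s (((φ (Submodule.Quotient.mk x))⁻¹ • φ) (Submodule.Quotient.mk x)) = y
    rw [h1]
    change LinearMap.toSpanSingleton A P y 1 = y
    simp
  · obtain ⟨t, ht⟩ := Ideal.Quotient.mk_surjective
      (((φ (Submodule.Quotient.mk x))⁻¹ • φ) (Submodule.Quotient.mk z))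
    change s (((φ (Submodule.Quotient.mk x))⁻¹ • φ) (Submodule.Quotient.mk z)) ∈ _
    rw [← ht]
    exact Submodule.mem_span_singleton.mpr ⟨t, rfl⟩

/-- Let `L ⊆ F` and `g ∈ F` with `𝔪 g ⊆ L`, and let `a ∈ 𝔪` be such that `a g ∉ 𝔪 L`. If maps
`L → N` extend to `F` and maps `L → Q / N` lift to `Q`, where `N ⊆ Q` with `Q` injective, then
every map `𝔪 → N` is multiplication by an element of `N`; that is, `Ext^1(k, N) = 0`. -/
theorem exists_eq_smul_of_extension_of_lift {A : Type u} [CommRing A] [IsLocalRing A]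
    {F N Q : Type u} [AddCommGroup F] [Module A F] [AddCommGroup N] [Module A N]
    [AddCommGroup Q] [Module A Q] [Module.Injective A Q] (i : N →ₗ[A] Q)
    (hi : Function.Injective i) (L : Submodule A F) (g : F)
    (hg : ∀ r ∈ maximalIdeal A, r • g ∈ L) (a : A) (ha : a ∈ maximalIdeal A)
    (hag : a • g ∉ maximalIdeal A • L)
    (hext : ∀ f : L →ₗ[A] N, ∃ h : F →ₗ[A] N, ∀ x : L, h x = f x)
    (hlift : ∀ f : L →ₗ[A] Q ⧸ LinearMap.range i,
      ∃ h : L →ₗ[A] Q, (LinearMap.range i).mkQ ∘ₗ h = f)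
    (φ : maximalIdeal A →ₗ[A] N) : ∃ c : N, ∀ r : maximalIdeal A, φ r = (r : A) • c := by
  obtain ⟨Φ, hΦ⟩ := Module.Injective.extension_property A Q _ _ (maximalIdeal A).subtype
    Subtype.val_injective (i ∘ₗ φ)
  have hq : ∀ r : maximalIdeal A, (r : A) • Φ 1 = i (φ r) := by
    intro r
    rw [← map_smul, smul_eq_mul, mul_one]
    exact LinearMap.congr_fun hΦ r
  have hag' : (⟨a • g, hg a ha⟩ : L) ∉ maximalIdeal A • (⊤ : Submodule A L) := by
    intro h
    have h' := Submodule.mem_map_of_mem (f := L.subtype) h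
    rw [Submodule.map_smul'', Submodule.map_subtype_top] at h'
    exact hag h'
  obtain ⟨ξ, hξ, hξ'⟩ := exists_linearMap_of_notMem_smul_top (⟨a • g, hg a ha⟩ : L) hag'
    ((LinearMap.range i).mkQ (Φ 1)) fun r hr => by
      rw [← map_smul, Submodule.mkQ_apply, Submodule.Quotient.mk_eq_zero]
      exact ⟨φ ⟨r, hr⟩, (hq ⟨r, hr⟩).symm⟩
  obtain ⟨ψ, hψ⟩ := hlift ξ
  have hψ' : ∀ x, (LinearMap.range i).mkQ (ψ x) = ξ x := LinearMap.congr_fun hψ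
  -- The map `a ψ` takes values in `N` since the image of `ξ` is killed by `𝔪`.
  have haψ : ∀ x, (a • ψ) x ∈ LinearMap.range i := by
    intro x
    rw [← Submodule.Quotient.mk_eq_zero, ← Submodule.mkQ_apply, LinearMap.smul_apply, map_smul,
      hψ']
    obtain ⟨t, ht⟩ := Submodule.mem_span_singleton.mp (hξ' x)
    rw [← ht, smul_comm, ← map_smul, hq ⟨a, ha⟩, Submodule.mkQ_apply,
      (Submodule.Quotient.mk_eq_zero _).mpr (LinearMap.mem_range_self i _), smul_zero]
  obtain ⟨θ, hθ⟩ := hext ((LinearEquiv.ofInjective i hi).symm.toLinearMap ∘ₗ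
    (a • ψ).codRestrict (LinearMap.range i) haψ)
  have hθ' : ∀ x : L, i (θ x) = a • ψ x := by
    intro x
    have h := congrArg Subtype.val ((LinearEquiv.ofInjective i hi).apply_symm_apply
      ((a • ψ).codRestrict (LinearMap.range i) haψ x))
    rw [hθ x]
    exact h
  obtain ⟨c, hc⟩ : Φ 1 - ψ ⟨a • g, hg a ha⟩ ∈ LinearMap.range i := by
    rw [← Submodule.Quotient.mk_eq_zero, ← Submodule.mkQ_apply, map_sub, hψ', hξ, sub_self]
  refine ⟨c + θ g, fun r => hi ?_⟩
  -- Here `r ψ(a g) = a ψ(r g) = θ(r g) = r θ(g)`, so `ψ(a g) - θ(g)` is killed by `𝔪`.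
  have hr : (r : A) • ψ ⟨a • g, hg a ha⟩ = (r : A) • i (θ g) := by
    have h := hθ' ⟨(r : A) • g, hg r r.2⟩
    rw [map_smul, map_smul] at h
    rw [h, ← map_smul, ← map_smul]
    congr 1
    exact Subtype.ext (smul_comm _ _ _)
  rw [← hq r, map_smul, map_add, hc, smul_add, smul_sub, hr, sub_add_cancel]

/-- The key property of a Burch ideal `I`, for which there are `a ∈ 𝔪` and `b ∈ I : 𝔪` with
`a b ∉ 𝔪 I`. Let `d` be a linear map between free modules over `R / I` with entries in the maximal
ideal. If `d g = b e_j`, then `a g` lies outside `𝔪 (ker d)`: lifting `d` to a matrix `D` over `R`,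
elements of `𝔪 (ker d)` lift to vectors mapped by `D` into `𝔪 I R ^ m`, whereas
`D (a g) ≡ a b e_j` modulo `𝔪 I R ^ m`. -/
theorem smul_notMem_smul_ker {R : Type u} [CommRing R] [IsLocalRing R] {I : Ideal R}
    [IsLocalRing (R ⧸ I)] {a b : R} (ha : a ∈ maximalIdeal R)
    (hab : a * b ∉ maximalIdeal R * I) {n m : ℕ} (d : (Fin n → R ⧸ I) →ₗ[R ⧸ I] (Fin m → R ⧸ I))
    (hd : ∀ v i, d v i ∈ maximalIdeal (R ⧸ I)) (g : Fin n → R ⧸ I) (j : Fin m)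
    (hg : d g = Pi.single j (Ideal.Quotient.mk I b)) :
    Ideal.Quotient.mk I a • g ∉ maximalIdeal (R ⧸ I) • LinearMap.ker d := by
  have hloc : IsLocalHom (Ideal.Quotient.mk I) := .of_surjective _ Ideal.Quotient.mk_surjective
  have hmax : ∀ r : R, Ideal.Quotient.mk I r ∈ maximalIdeal (R ⧸ I) → r ∈ maximalIdeal R :=
    fun r hr h => hr (h.map _)
  -- `D` is a lift of `d` to a map between free modules over `R`.
  choose c hc using fun (k : Fin n) (i : Fin m) =>
    Ideal.Quotient.mk_surjective (d (Pi.single k 1) i)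
  let D : (Fin n → R) → Fin m → R := fun z i => ∑ k, z k * c k i
  have hcm : ∀ k i, c k i ∈ maximalIdeal R := fun k i => hmax _ (by rw [hc]; exact hd _ _)
  have hD : ∀ z i, Ideal.Quotient.mk I (D z i) = d (fun k => Ideal.Quotient.mk I (z k)) i := by
    intro z i
    conv_rhs => rw [pi_eq_sum_univ' (fun k => Ideal.Quotient.mk I (z k)), map_sum]
    simp [D, hc]
  have hDadd : ∀ z w i, D (z + w) i = D z i + D w i := by
    intro z w i
    simp [D, add_mul, Finset.sum_add_distrib]
  have hDsmul : ∀ r z i, D (r • z) i = r * D z i := by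
    intro r z i
    simp [D, Finset.mul_sum, mul_assoc]
  have hDI : ∀ z : Fin n → R, (∀ k, z k ∈ I) → ∀ i, D z i ∈ maximalIdeal R * I := by
    intro z hz i
    refine Ideal.sum_mem _ fun k _ => ?_
    rw [mul_comm (z k)]
    exact Ideal.mul_mem_mul (hcm k i) (hz k)
  intro hmem
  obtain ⟨z, hz, hzD⟩ : ∃ z : Fin n → R, (fun k => Ideal.Quotient.mk I (z k)) =
      Ideal.Quotient.mk I a • g ∧ ∀ i, D z i ∈ maximalIdeal R * I := by
    refine Submodule.smul_induction_on (p := fun x => ∃ z : Fin n → R,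
      (fun k => Ideal.Quotient.mk I (z k)) = x ∧
        ∀ i, D z i ∈ maximalIdeal R * I) hmem ?_ ?_
    · intro r hr x hx
      obtain ⟨r, rfl⟩ := Ideal.Quotient.mk_surjective r
      choose z hz using fun k => Ideal.Quotient.mk_surjective (x k)
      refine ⟨r • z, by ext k; simp [hz], fun i => ?_⟩
      rw [hDsmul]
      refine Ideal.mul_mem_mul (hmax r hr) ?_
      rw [← Ideal.Quotient.eq_zero_iff_mem, hD, funext hz, LinearMap.mem_ker.mp hx]
      rfl
    · rintro x y ⟨z, hz, hz'⟩ ⟨w, hw, hw'⟩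
      refine ⟨z + w, ?_, fun i => ?_⟩
      · rw [← hz, ← hw]
        ext k
        simp
      · rw [hDadd]
        exact add_mem (hz' i) (hw' i)
  choose G hG using fun k => Ideal.Quotient.mk_surjective (g k)
  have h1 : ∀ k, (z - a • G) k ∈ I := by
    intro k
    rw [← Ideal.Quotient.eq_zero_iff_mem]
    simpa [hG, sub_eq_zero] using congrFun hz k
  have h2 : a * D G j ∈ maximalIdeal R * I := by
    have h := sub_mem (hzD j) (hDI _ h1 j)
    rw [← hDsmul]
    convert h using 1
    rw [sub_eq_add_neg z, ← neg_one_smul R (a • G), hDadd, hDsmul (-1)]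
    ring
  have h3 : D G j - b ∈ I := by
    rw [← Ideal.Quotient.eq_zero_iff_mem, map_sub, hD, funext hG, hg]
    simp
  refine hab ?_
  have h4 := sub_mem h2 (Ideal.mul_mem_mul ha h3)
  convert h4 using 1
  ring

/-- Every module embeds into an injective module. -/
theorem exists_injective_embedding (A : Type u) [CommRing A] (N : Type u) [AddCommGroup N]
    [Module A N] : ∃ (Q : Type u) (_ : AddCommGroup Q) (_ : Module A Q) (i : N →ₗ[A] Q),
      Module.Injective A Q ∧ Function.Injective i := by
  let Q : ModuleCat.{u} A := Injective.under (ModuleCat.of A N)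
  have hQ : Injective (ModuleCat.of A Q) :=
    inferInstanceAs (Injective (Injective.under (ModuleCat.of A N)))
  exact ⟨Q, inferInstance, inferInstance, (Injective.ι (ModuleCat.of A N)).hom,
    Module.injective_module_of_injective_object _ _,
    (ModuleCat.mono_iff_injective _).mp inferInstance⟩

/-- Over the quotient by a Burch ideal, with `a` and `b` as in `smul_notMem_smul_ker`: if a
nonzero finitely generated module `M` is killed by `b` and `Ext^i(M, N) = 0` for all `i > 0`, then
every map `𝔪 → N` is multiplication by an element of `N`; that is, `Ext^1(k, N) = 0`. -/
theorem exists_eq_smul_of_subsingleton_ext {R : Type u} [CommRing R] [IsLocalRing R]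
    [IsNoetherianRing R] {I : Ideal R} [IsLocalRing (R ⧸ I)] {a b : R} (ha : a ∈ maximalIdeal R)
    (hb : b ∈ I.colon (maximalIdeal R : Set R)) (hab : a * b ∉ maximalIdeal R * I)
    (M N : Type u) [AddCommGroup M] [Module (R ⧸ I) M] [Module.Finite (R ⧸ I) M] [Nontrivial M]
    [AddCommGroup N] [Module (R ⧸ I) N] (hM : ∀ x : M, Ideal.Quotient.mk I b • x = 0)
    (hext : ∀ i : ℕ, 0 < i →
      Subsingleton (Abelian.Ext (ModuleCat.of (R ⧸ I) M) (ModuleCat.of (R ⧸ I) N) i))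
    (φ : maximalIdeal (R ⧸ I) →ₗ[R ⧸ I] N) :
    ∃ c : N, ∀ r : maximalIdeal (R ⧸ I), φ r = (r : R ⧸ I) • c := by
  have hloc : IsLocalHom (Ideal.Quotient.mk I) := .of_surjective _ Ideal.Quotient.mk_surjective
  obtain ⟨m, p, hp, hpm⟩ := exists_minimal_free_cover (A := R ⧸ I) M
  obtain ⟨j⟩ : Nonempty (Fin m) := by
    by_contra h
    rw [not_nonempty_iff] at h
    exact not_subsingleton M hp.subsingleton
  obtain ⟨n, q, hq⟩ := Module.Finite.exists_fin' (R ⧸ I) (LinearMap.ker p)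
  have hker : LinearMap.ker ((LinearMap.ker p).subtype ∘ₗ q) = LinearMap.ker q :=
    LinearMap.ker_comp_of_ker_eq_bot _ (Submodule.ker_subtype _)
  have hbj : Pi.single j (Ideal.Quotient.mk I b) ∈ LinearMap.ker p := by
    have h : Pi.single j (Ideal.Quotient.mk I b) =
        Ideal.Quotient.mk I b • (Pi.single j 1 : Fin m → R ⧸ I) := by
      rw [← Pi.single_smul, smul_eq_mul, mul_one]
    rw [h, LinearMap.mem_ker, map_smul, hM]
  obtain ⟨g, hg⟩ := hq ⟨_, hbj⟩
  have hgL : ∀ r ∈ maximalIdeal (R ⧸ I), r • g ∈ LinearMap.ker q := by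
    intro r hr
    obtain ⟨r, rfl⟩ := Ideal.Quotient.mk_surjective r
    have hrm : r ∈ maximalIdeal R := fun h => hr (h.map _)
    rw [LinearMap.mem_ker, map_smul, hg]
    ext1
    change Ideal.Quotient.mk I r • Pi.single j (Ideal.Quotient.mk I b) = 0
    rw [← Pi.single_smul, smul_eq_mul, ← map_mul, Ideal.Quotient.eq_zero_iff_mem.mpr,
      Pi.single_zero]
    rw [mul_comm]
    exact Submodule.mem_colon.mp hb r hrm
  have hnot := smul_notMem_smul_ker ha hab ((LinearMap.ker p).subtype ∘ₗ q)
    (fun v i => hpm _ (q v).2 i) g j (congrArg Subtype.val hg)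
  rw [hker] at hnot
  obtain ⟨Q, _, _, i, _, hi⟩ := exists_injective_embedding (R ⧸ I) N
  have hext₁ := subsingleton_ext_ker p hp hext
  have hext₂ := subsingleton_ext_ker q hq hext₁
  refine exists_eq_smul_of_extension_of_lift i hi (LinearMap.ker q) g hgL
    (Ideal.Quotient.mk I a) (fun h => ha (h.of_map)) hnot
    (exists_extension_of_subsingleton_ext_one q hq (hext₁ 1 one_pos))
    (exists_lift_of_subsingleton_ext_one i (LinearMap.range i).mkQ hi
      (Submodule.mkQ_surjective _) ?_ (hext₂ 1 one_pos)) φ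
  rw [LinearMap.exact_iff, Submodule.ker_mkQ]

/-! ### Injective modules over Artinian local rings -/

section Artinian

variable {A : Type u} [CommRing A] [IsLocalRing A]

/-- A nonzero module over a local ring with nilpotent maximal ideal has a nonzero element killed by
the maximal ideal. -/
theorem exists_ne_zero_smul_eq_zero (hA : IsNilpotent (maximalIdeal A)) (M : Type*)
    [AddCommGroup M] [Module A M] [Nontrivial M] :
    ∃ x : M, x ≠ 0 ∧ ∀ r ∈ maximalIdeal A, r • x = 0 := by
  classical
  have hex : ∃ n, maximalIdeal A ^ n • (⊤ : Submodule A M) = ⊥ := by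
    obtain ⟨n, hn⟩ := hA
    exact ⟨n, by rw [hn]; exact Submodule.bot_smul _⟩
  have hne : Nat.find hex ≠ 0 := by
    intro h
    have h1 := Nat.find_spec hex
    rw [h, pow_zero, Ideal.one_eq_top, Submodule.top_smul] at h1
    exact top_ne_bot h1
  obtain ⟨n, hn⟩ := Nat.exists_eq_succ_of_ne_zero hne
  have h1 := Nat.find_min hex (m := n) (by lia)
  obtain ⟨x, hx, hx0⟩ := Submodule.exists_mem_ne_zero_of_ne_bot h1
  refine ⟨x, hx0, fun r hr => ?_⟩
  have h2 := Nat.find_spec hex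
  rw [hn, pow_succ', Submodule.mul_smul] at h2
  rw [← Submodule.mem_bot A, ← h2]
  exact Submodule.smul_mem_smul hr hx

/-- Over an Artinian local ring, `N` is injective as soon as every map `𝔪 → N` extends to the ring,
that is, as soon as `Ext^1(k, N) = 0`. -/
theorem injective_of_forall_exists_eq_smul [IsNoetherianRing A] (hA : IsNilpotent (maximalIdeal A))
    (N : Type u) [AddCommGroup N] [Module A N]
    (h : ∀ φ : maximalIdeal A →ₗ[A] N, ∃ c : N, ∀ r : maximalIdeal A, φ r = (r : A) • c) :
    Module.Injective A N := by
  refine Module.Baer.injective fun J f => ?_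
  let f₀ : A →ₗ.[A] N := ⟨J, f⟩
  -- By Noetherianity, `f` has an extension with maximal domain.
  obtain ⟨D, ⟨g, hg, rfl⟩, hmax⟩ := set_has_maximal_iff_noetherian.mpr ‹IsNoetherianRing A›
    {D : Ideal A | ∃ g : A →ₗ.[A] N, f₀ ≤ g ∧ g.domain = D} ⟨J, f₀, le_rfl, rfl⟩
  suffices htop : g.domain = ⊤ by
    refine ⟨g.toFun ∘ₗ LinearMap.codRestrict g.domain LinearMap.id fun x => ?_, fun x hx => ?_⟩
    · rw [htop]; trivial
    · exact (hg.2 (x := ⟨x, hx⟩) rfl).symm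
  by_contra hne
  have : Nontrivial (A ⧸ g.domain) := Submodule.Quotient.nontrivial_iff.mpr hne
  obtain ⟨y, hy0, hy⟩ := exists_ne_zero_smul_eq_zero hA (A ⧸ g.domain)
  obtain ⟨y, rfl⟩ := Submodule.Quotient.mk_surjective _ y
  rw [Ne, Submodule.Quotient.mk_eq_zero] at hy0
  have hyD : ∀ r ∈ maximalIdeal A, r * y ∈ g.domain := by
    intro r hr
    have := hy r hr
    rwa [← Submodule.Quotient.mk_smul, Submodule.Quotient.mk_eq_zero] at this
  obtain ⟨c, hc⟩ := h (g.toFun ∘ₗ LinearMap.codRestrict g.domain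
    ((LinearMap.toSpanSingleton A A y) ∘ₗ (maximalIdeal A).subtype) fun r => hyD r r.2)
  -- Define the extension on the domain plus `A y` by sending `y` to `c`.
  have hgc : ∀ r (hr : r ∈ maximalIdeal A), g ⟨r * y, hyD r hr⟩ = r • c :=
    fun r hr => hc ⟨r, hr⟩
  have hrm : ∀ r, r * y ∈ g.domain → r ∈ maximalIdeal A := by
    intro r hr hu
    exact hy0 ((Submodule.smul_mem_iff_of_isUnit _ hu).mp hr)
  let s : A →ₗ.[A] N := LinearPMap.mkSpanSingleton' y c fun r hr => by
    have hr' : r * y = 0 := hr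
    have hrm' := hrm r (by rw [hr']; exact zero_mem _)
    rw [RingHom.id_apply, ← hgc r hrm', ← g.map_zero]
    congr 1
    exact Subtype.ext hr'
  have hs : ∀ (x : g.domain) (z : s.domain), (x : A) = z → g x = s z := by
    rintro ⟨x, hx⟩ ⟨z, hz⟩ rfl
    obtain ⟨r, rfl⟩ := Submodule.mem_span_singleton.mp hz
    rw [LinearPMap.mkSpanSingleton'_apply]
    exact hgc r (hrm r hx)
  refine hmax (g.sup s hs).domain ⟨_, hg.trans (g.left_le_sup s hs), rfl⟩
    (lt_of_le_of_ne le_sup_left fun h => hy0 ?_)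
  rw [h]
  exact (le_sup_right : s.domain ≤ g.domain ⊔ s.domain) (Submodule.mem_span_singleton_self y)

end Artinian

/-! ### Modules with simple socle and canonical modules -/

section Canonical

variable {A : Type u} [CommRing A] [IsLocalRing A]

/-- The element `x` generates the socle of `M`, the submodule of the elements killed by the maximal
ideal, and the socle is nonzero (hence a one-dimensional vector space over the residue field). -/
structure IsSimpleSocleGenerator {M : Type*} [AddCommGroup M] [Module A M] (x : M) : Prop where
  ne_zero : x ≠ 0
  smul_eq_zero : ∀ r ∈ maximalIdeal A, r • x = 0
  mem_span : ∀ y : M, (∀ r ∈ maximalIdeal A, r • y = 0) → y ∈ Submodule.span A {x}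

/-- The linear map from the residue field sending `1` to a given element killed by `𝔪`. -/
noncomputable def residueFieldToModule {M : Type*} [AddCommGroup M] [Module A M] (x : M)
    (hx : ∀ r ∈ maximalIdeal A, r • x = 0) : ResidueField A →ₗ[A] M :=
  Submodule.liftQ (maximalIdeal A) (LinearMap.toSpanSingleton A M x)
    fun r hr => by simpa using hx r hr

theorem residueFieldToModule_residue {M : Type*} [AddCommGroup M] [Module A M] (x : M)
    (hx : ∀ r ∈ maximalIdeal A, r • x = 0) (r : A) :
    residueFieldToModule x hx (residue A r) = r • x :=
  rfl

theorem smul_residueField_eq_zero {r : A} (hr : r ∈ maximalIdeal A) (t : ResidueField A) :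
    r • t = 0 := by
  rw [Algebra.smul_def, ResidueField.algebraMap_eq, (residue_eq_zero_iff r).mpr hr, zero_mul]

/-- If the socle of `M` is simple then `Hom(k, M)` is isomorphic to the residue field `k`. -/
theorem IsSimpleSocleGenerator.nonempty_linearEquiv {M : Type*} [AddCommGroup M] [Module A M]
    {x : M} (hx : IsSimpleSocleGenerator (A := A) x) :
    Nonempty ((ResidueField A →ₗ[A] M) ≃ₗ[A] ResidueField A) := by
  let s := residueFieldToModule x hx.smul_eq_zero
  have hker : LinearMap.ker (LinearMap.toSpanSingleton A (ResidueField A →ₗ[A] M) s) =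
      maximalIdeal A := by
    ext r
    rw [LinearMap.mem_ker, LinearMap.toSpanSingleton_apply]
    constructor
    · intro h hu
      refine hx.ne_zero (hu.smul_eq_zero.mp ?_)
      have h1 := LinearMap.congr_fun h (residue A 1)
      rwa [LinearMap.smul_apply, residueFieldToModule_residue, one_smul] at h1
    · intro hr
      ext t
      rw [LinearMap.smul_apply, ← map_smul, smul_residueField_eq_zero hr, map_zero]
      rfl
  have hsurj : Function.Surjective (LinearMap.toSpanSingleton A (ResidueField A →ₗ[A] M) s) := by
    intro f
    obtain ⟨t, ht⟩ := Submodule.mem_span_singleton.mp (hx.mem_span (f 1) fun r hr => by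
      rw [← map_smul, smul_residueField_eq_zero hr, map_zero])
    refine ⟨t, ?_⟩
    ext z
    obtain ⟨z, rfl⟩ := residue_surjective z
    have hz : residue A z = z • (1 : ResidueField A) := by
      rw [Algebra.smul_def, mul_one, ResidueField.algebraMap_eq]
    rw [LinearMap.toSpanSingleton_apply, LinearMap.smul_apply, residueFieldToModule_residue,
      hz, map_smul, ← ht, smul_comm]
  exact ⟨(LinearMap.quotKerEquivOfSurjective _ hsurj).symm ≪≫ₗ
    Submodule.quotEquivOfEq _ _ hker⟩

/-- A canonical module over a local ring of dimension zero has a simple socle. -/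
theorem IsCanonicalModule.exists_isSimpleSocleGenerator (hdim : ringKrullDim A = 0) {K : Type u}
    [AddCommGroup K] [Module A K] (hK : IsCanonicalModule A K) :
    ∃ x : K, IsSimpleSocleGenerator (A := A) x := by
  obtain ⟨e⟩ := hK.nonempty_ext_equiv 0 (by rw [hdim]; rfl)
  let e' : (ResidueField A →ₗ[A] K) ≃ₗ[A] ResidueField A :=
    (ModuleCat.homLinearEquiv (S := A) (M := ModuleCat.of A (ResidueField A))
      (N := ModuleCat.of A K)).symm ≪≫ₗ
      (Abelian.Ext.linearEquiv₀ (R := A)).symm ≪≫ₗ e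
  let s := e'.symm 1
  have hs : ∀ (f : ResidueField A →ₗ[A] K), ∃ t : A, f = t • s := by
    intro f
    obtain ⟨t, ht⟩ := residue_surjective (e' f)
    refine ⟨t, ?_⟩
    rw [← map_smul, LinearEquiv.eq_symm_apply, ← ht, Algebra.smul_def, mul_one,
      ResidueField.algebraMap_eq]
  refine ⟨s 1, ⟨fun h => ?_, fun r hr => ?_, fun y hy => ?_⟩⟩
  · have h0 : s = 0 := by
      ext z
      obtain ⟨z, rfl⟩ := residue_surjective z
      have hz : residue A z = z • (1 : ResidueField A) := by
        rw [Algebra.smul_def, mul_one, ResidueField.algebraMap_eq]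
      rw [hz, map_smul, h, smul_zero, LinearMap.zero_apply]
    exact one_ne_zero ((LinearEquiv.map_eq_zero_iff e'.symm).mp h0)
  · rw [← map_smul, smul_residueField_eq_zero hr, map_zero]
  · obtain ⟨t, ht⟩ := hs (residueFieldToModule y hy)
    have h1 := LinearMap.congr_fun ht (residue A 1)
    rw [residueFieldToModule_residue, one_smul] at h1
    exact Submodule.mem_span_singleton.mpr ⟨t, by rw [h1]; simp⟩

/-- A canonical module over an Artinian local ring is injective. -/
theorem IsCanonicalModule.injective [IsNoetherianRing A] (hA : IsNilpotent (maximalIdeal A))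
    (hdim : ringKrullDim A = 0) {K : Type u} [AddCommGroup K] [Module A K]
    (hK : IsCanonicalModule A K) : Module.Injective A K := by
  refine injective_of_forall_exists_eq_smul hA K fun φ => ?_
  have hker : LinearMap.ker (Algebra.linearMap A (ResidueField A)) ≤ maximalIdeal A :=
    fun r hr => (residue_eq_zero_iff r).mp hr
  obtain ⟨g, hg⟩ := exists_extension_of_subsingleton_ext_one
    (Algebra.linearMap A (ResidueField A)) residue_surjective
    (hK.subsingleton_ext 1 (by rw [hdim]; exact one_ne_zero)) (φ ∘ₗ Submodule.inclusion hker)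
  refine ⟨g 1, fun r => ?_⟩
  rw [← map_smul, smul_eq_mul, mul_one]
  exact (hg ⟨r, (residue_eq_zero_iff _).mpr r.2⟩).symm

/-- If the maximal ideal is finitely generated and nilpotent, then a module whose socle is finitely
generated is finitely generated. The multiplications by generators of `𝔪` embed `M / soc M` into a
power of `𝔪 M`, which is killed by a smaller power of `𝔪`. -/
theorem finite_of_finite_socle [IsNoetherianRing A] (n : ℕ) (M : Type u) [AddCommGroup M]
    [Module A M] (hn : ∀ r ∈ maximalIdeal A ^ n, ∀ x : M, r • x = 0) (S : Submodule A M)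
    (hSfg : S.FG) (hS : ∀ x : M, (∀ r ∈ maximalIdeal A, r • x = 0) → x ∈ S) :
    Module.Finite A M := by
  induction n generalizing M with
  | zero =>
    have h : ∀ x : M, x = 0 := fun x => by
      simpa using hn 1 (by simp) x
    have : Subsingleton M := subsingleton_of_forall_eq 0 h
    infer_instance
  | succ n ih =>
    let M' : Submodule A M := maximalIdeal A • ⊤
    have hM' : Module.Finite A M' := by
      have hSn : IsNoetherian A S := isNoetherian_of_fg_of_noetherian S hSfg
      refine ih M' ?_ (S.comap M'.subtype) ?_ ?_
      · rintro r hr ⟨x, hx⟩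
        ext1
        change r • x = 0
        refine Submodule.smul_induction_on hx (fun t ht y _ => ?_) fun y z hy hz => ?_
        · rw [← mul_smul]
          exact hn _ (by rw [pow_succ]; exact Ideal.mul_mem_mul hr ht) y
        · rw [smul_add, hy, hz, add_zero]
      · have := isNoetherian_of_injective
          (M'.subtype.restrict (p := S.comap M'.subtype) (q := S) fun x hx => hx)
          fun x y hxy => Subtype.ext (Subtype.ext (congrArg (fun z : S => (z : M)) hxy))
        exact (Submodule.fg_top _).mp (IsNoetherian.noetherian ⊤)
      · intro x hx
        exact hS x fun r hr => congrArg Subtype.val (hx r hr)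
    obtain ⟨s, v, hv⟩ := Submodule.fg_iff_exists_fin_generating_family.mp
      (IsNoetherian.noetherian (maximalIdeal A))
    have hvm : ∀ i, v i ∈ maximalIdeal A := fun i => hv ▸ Submodule.subset_span ⟨i, rfl⟩
    let f : M →ₗ[A] (Fin s → M') := LinearMap.pi fun i =>
      (LinearMap.lsmul A M (v i)).codRestrict M' fun x =>
        Submodule.smul_mem_smul (hvm i) trivial
    refine ⟨Submodule.fg_of_fg_map_of_fg_inf_ker f ?_ ?_⟩
    · have : IsNoetherian A M' := isNoetherian_of_isNoetherianRing_of_finite A M'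
      exact IsNoetherian.noetherian _
    · have hSn : IsNoetherian A S := isNoetherian_of_fg_of_noetherian S hSfg
      rw [top_inf_eq]
      have hle : LinearMap.ker f ≤ S := by
        intro x hx
        refine hS x fun r hr => ?_
        rw [← hv] at hr
        refine Submodule.span_induction (p := fun r _ => r • x = 0) ?_ (zero_smul _ _) ?_ ?_ hr
        · rintro _ ⟨i, rfl⟩
          exact congrArg Subtype.val (congrFun (LinearMap.mem_ker.mp hx) i)
        · intro a b _ _ ha hb
          rw [add_smul, ha, hb, add_zero]
        · intro a b _ hb
          rw [smul_assoc, hb, smul_zero]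
      have := isNoetherian_of_le hle
      exact (Submodule.fg_top _).mp (IsNoetherian.noetherian ⊤)

/-- The injective hull of the residue field: an Artinian local ring has a finitely generated
injective module with simple socle. -/
theorem exists_injective_isSimpleSocleGenerator [IsNoetherianRing A]
    (hA : IsNilpotent (maximalIdeal A)) :
    ∃ (E : Type u) (_ : AddCommGroup E) (_ : Module A E) (x : E),
      Module.Finite A E ∧ Module.Injective A E ∧ IsSimpleSocleGenerator (A := A) x := by
  obtain ⟨Q, _, _, i, _, hi⟩ := exists_injective_embedding A (ResidueField A)
  let S : Set (Submodule A Q) := {H | i 1 ∈ H ∧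
    ∀ y ∈ H, (∀ r ∈ maximalIdeal A, r • y = 0) → y ∈ Submodule.span A {i 1}}
  have h1 : ∀ r ∈ maximalIdeal A, r • i 1 = 0 := fun r hr => by
    rw [← map_smul, smul_residueField_eq_zero hr, map_zero]
  -- `E` is a maximal submodule of `Q` with socle generated by the image of `1`.
  obtain ⟨E, -, hE, hmax⟩ := zorn_le_nonempty₀ S (fun c hc hchain y hy => by
    refine ⟨sSup c, ⟨?_, fun z hz hz' => ?_⟩, fun H hH => le_sSup hH⟩
    · exact le_sSup hy (hc hy).1
    · obtain ⟨H, hH, hzH⟩ :=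
        (Submodule.mem_sSup_of_directed ⟨y, hy⟩ hchain.directedOn).mp hz
      exact (hc hH).2 z hzH hz') (Submodule.span A {i 1})
    ⟨Submodule.mem_span_singleton_self _, fun y hy _ => hy⟩
  have hgen : IsSimpleSocleGenerator (A := A) (⟨i 1, hE.1⟩ : E) := by
    refine ⟨fun h => ?_, fun r hr => Subtype.ext (h1 r hr), fun y hy => ?_⟩
    · have h0 : i 1 = i 0 := (congrArg Subtype.val h).trans (map_zero i).symm
      exact one_ne_zero (hi h0)
    · obtain ⟨t, ht⟩ := Submodule.mem_span_singleton.mp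
        (hE.2 y y.2 fun r hr => congrArg Subtype.val (hy r hr))
      exact Submodule.mem_span_singleton.mpr ⟨t, Subtype.ext ht⟩
  refine ⟨E, inferInstance, inferInstance, ⟨i 1, hE.1⟩, ?_, ?_, hgen⟩
  · obtain ⟨n, hn⟩ := hA
    exact finite_of_finite_socle n E (fun r hr x => by
      rw [hn] at hr
      rw [(Submodule.mem_bot A).mp hr, zero_smul]) _ (Submodule.fg_span_singleton _) hgen.mem_span
  · refine injective_of_forall_exists_eq_smul hA E fun φ => ?_
    obtain ⟨Φ, hΦ⟩ := Module.Injective.extension_property A Q _ _ (maximalIdeal A).subtype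
      Subtype.val_injective (E.subtype ∘ₗ φ)
    have hq : ∀ r : maximalIdeal A, (r : A) • Φ 1 = φ r := by
      intro r
      rw [← map_smul, smul_eq_mul, mul_one]
      exact LinearMap.congr_fun hΦ r
    by_cases hqE : Φ 1 ∈ E
    · exact ⟨⟨Φ 1, hqE⟩, fun r => Subtype.ext (hq r).symm⟩
    -- By maximality, `E + A q` has a socle element outside `E`, which yields an element `q + e`
    -- killed by `𝔪`.
    have hnot : E ⊔ Submodule.span A {Φ 1} ∉ S := fun h =>
      hqE (hmax h le_sup_left
        ((le_sup_right : _ ≤ E ⊔ Submodule.span A {Φ 1}) (Submodule.mem_span_singleton_self _)))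
    obtain ⟨y, hy, hy0, hyspan⟩ : ∃ y ∈ E ⊔ Submodule.span A {Φ 1},
        (∀ r ∈ maximalIdeal A, r • y = 0) ∧ y ∉ Submodule.span A {i 1} := by
      by_contra! h
      exact hnot ⟨(le_sup_left : E ≤ _) hE.1, h⟩
    obtain ⟨e, he, z, hz, rfl⟩ := Submodule.mem_sup.mp hy
    obtain ⟨t, rfl⟩ := Submodule.mem_span_singleton.mp hz
    have ht : IsUnit t := by
      by_contra ht
      refine hyspan (hE.2 _ (add_mem he ?_) hy0)
      rw [hq ⟨t, ht⟩]
      exact (φ _).2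
    obtain ⟨t, rfl⟩ := ht
    refine ⟨-((t⁻¹ : Aˣ) : A) • ⟨e, he⟩, fun r => Subtype.ext ?_⟩
    have h2 := congrArg (fun w => ((t⁻¹ : Aˣ) : A) • w) (hy0 r r.2)
    simp only [smul_add, smul_zero] at h2
    rw [smul_comm (r : A) (t : A), smul_smul (_ : A) (t : A), Units.inv_mul, one_smul, hq r] at h2
    rw [eq_neg_of_add_eq_zero_right h2]
    change -(((t⁻¹ : Aˣ) : A) • (r : A) • e) = (r : A) • (-((t⁻¹ : Aˣ) : A) • e)
    rw [neg_smul, smul_neg, smul_comm]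

/-- Over a local ring of dimension zero, a finitely generated injective module with simple socle is
a canonical module. -/
theorem isCanonicalModule_of_injective (hdim : ringKrullDim A = 0) (E : Type u) [AddCommGroup E]
    [Module A E] [Module.Finite A E] [Module.Injective A E] {x : E}
    (hx : IsSimpleSocleGenerator (A := A) x) : IsCanonicalModule A E where
  finite := inferInstance
  nonempty_ext_equiv i hi := by
    obtain rfl : i = 0 := by
      rw [hdim] at hi
      exact_mod_cast hi
    obtain ⟨e⟩ := hx.nonempty_linearEquiv
    exact ⟨Abelian.Ext.linearEquiv₀ (R := A) ≪≫ₗ ModuleCat.homLinearEquiv (S := A) ≪≫ₗ e⟩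
  subsingleton_ext i hi := by
    obtain ⟨n, rfl⟩ : ∃ n, i = n + 1 := Nat.exists_eq_succ_of_ne_zero fun h => hi (by
      rw [h, hdim]; rfl)
    have := Module.injective_object_of_injective_module A E
    exact subsingleton_of_forall_eq 0 fun y => Abelian.Ext.eq_zero_of_injective y

/-- An injective module all of whose endomorphisms are homotheties, in a unique way, is isomorphic
to any injective module with simple socle: the latter embeds as a direct summand, and the projection
onto it is multiplication by an idempotent of the local ring. -/
theorem nonempty_linearEquiv_of_injective [IsNoetherianRing A] (hA : IsNilpotent (maximalIdeal A))
    {C K : Type u} [AddCommGroup C] [Module A C] [AddCommGroup K] [Module A K]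
    [Module.Injective A C] [Module.Injective A K] {x : K}
    (hx : IsSimpleSocleGenerator (A := A) x)
    (hC : Function.Bijective (LinearMap.lsmul A C : A → (C →ₗ[A] C))) :
    Nonempty (C ≃ₗ[A] K) := by
  have hCnt : Nontrivial C := by
    by_contra h
    rw [not_nontrivial_iff_subsingleton] at h
    exact one_ne_zero (hC.1 (Subsingleton.elim (LinearMap.lsmul A C 1) (LinearMap.lsmul A C 0)))
  obtain ⟨y, hy0, hy⟩ := exists_ne_zero_smul_eq_zero hA C
  have hinj : Function.Injective (residueFieldToModule x hx.smul_eq_zero) := by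
    rw [← LinearMap.ker_eq_bot, LinearMap.ker_eq_bot']
    intro t ht
    obtain ⟨t, rfl⟩ := residue_surjective t
    rw [residueFieldToModule_residue] at ht
    rw [residue_eq_zero_iff]
    exact fun hu => hx.ne_zero (hu.smul_eq_zero.mp ht)
  obtain ⟨ι, hι⟩ := Module.Injective.extension_property A C _ _ _ hinj (residueFieldToModule y hy)
  have hιx : ι x = y := by
    have h := LinearMap.congr_fun hι (residue A 1)
    rwa [LinearMap.comp_apply, residueFieldToModule_residue, residueFieldToModule_residue,
      one_smul, one_smul] at h
  have hιinj : Function.Injective ι := by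
    rw [← LinearMap.ker_eq_bot]
    by_contra hne
    have : Nontrivial (LinearMap.ker ι) := (Submodule.nontrivial_iff_ne_bot).mpr hne
    obtain ⟨z, hz0, hz⟩ := exists_ne_zero_smul_eq_zero hA (LinearMap.ker ι)
    obtain ⟨t, ht⟩ := Submodule.mem_span_singleton.mp
      (hx.mem_span z fun r hr => congrArg Subtype.val (hz r hr))
    have hu : IsUnit t := by
      by_contra hu
      exact hz0 (Subtype.ext (by rw [← ht]; exact hx.smul_eq_zero t hu))
    have h := LinearMap.mem_ker.mp z.2
    rw [← ht, map_smul, hιx] at h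
    exact hy0 (hu.smul_eq_zero.mp h)
  obtain ⟨ρ, hρ⟩ := Module.Injective.extension_property A K _ _ ι hιinj LinearMap.id
  obtain ⟨e, he⟩ := hC.2 (ι ∘ₗ ρ)
  have he' : ∀ c, e • c = ι (ρ c) := LinearMap.congr_fun he
  have hρ' : ∀ k, ρ (ι k) = k := LinearMap.congr_fun hρ
  have hidem : e * (1 - e) = 0 := by
    refine hC.1 (LinearMap.ext fun c => ?_)
    simp only [LinearMap.lsmul_apply, mul_smul, sub_smul, one_smul, he', map_sub, hρ', sub_self,
      map_zero, LinearMap.zero_apply]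
  have heu : IsUnit e := by
    refine (isUnit_or_isUnit_one_sub_self e).resolve_right fun h => hy0 ?_
    have h0 : e = 0 := (h.mul_left_eq_zero).mp hidem
    rw [← hιx, ← hρ' x, ← he', h0, zero_smul]
  have he1 : e = 1 := by
    have h0 := heu.mul_right_eq_zero.mp hidem
    exact (sub_eq_zero.mp h0).symm
  exact ⟨LinearEquiv.ofLinearMap ρ ι hρ (by rw [← he, he1]; ext c; simp)⟩

/-- A finite free module whose only endomorphisms are the homotheties has rank one. -/
theorem nonempty_linearEquiv_of_free {C : Type u} [AddCommGroup C] [Module A C] {n : ℕ}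
    (p : (Fin n → A) ≃ₗ[A] C)
    (hC : Function.Bijective (LinearMap.lsmul A C : A → (C →ₗ[A] C))) :
    Nonempty (C ≃ₗ[A] A) := by
  classical
  obtain ⟨j⟩ : Nonempty (Fin n) := by
    by_contra h
    rw [not_nonempty_iff] at h
    have : Subsingleton C := p.symm.injective.subsingleton
    exact one_ne_zero (hC.1 (Subsingleton.elim (LinearMap.lsmul A C 1) (LinearMap.lsmul A C 0)))
  -- The projection onto one coordinate is a homothety, so there is only that coordinate.
  obtain ⟨r, hr⟩ := hC.2 (p.toLinearMap ∘ₗ LinearMap.single A (fun _ => A) j ∘ₗ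
    LinearMap.proj j ∘ₗ p.symm.toLinearMap)
  have hr' : ∀ v, r • v = Pi.single j (v j) := by
    intro v
    have h := LinearMap.congr_fun hr (p v)
    rw [LinearMap.lsmul_apply, ← map_smul] at h
    simpa using p.injective h
  have hr1 : r = 1 := by simpa using congrFun (hr' (Pi.single j 1)) j
  have huniq : ∀ i, i = j := by
    intro i
    by_contra hij
    have h := congrFun (hr' (Pi.single i 1)) i
    rw [hr1] at h
    simp [hij] at h
  let _ : Unique (Fin n) := ⟨⟨j⟩, huniq⟩
  exact ⟨p.symm ≪≫ₗ LinearEquiv.funUnique (Fin n) A A⟩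

end Canonical

/-! ### Semidualizing modules over the quotient by a Burch ideal -/

theorem corollary2p12 (R : Type u) [CommRing R] [IsLocalRing R] [IsNoetherianRing R] (I : Ideal R)
    (hprimary : I.IsPrimary) (hradical : I.radical = IsLocalRing.maximalIdeal R)
    (hburch : IsBurchIdeal I) :
    ∃ _ : IsLocalRing (R ⧸ I), HasOnlyTrivialSemidualizingModules (R ⧸ I) := by
  have : Nontrivial (R ⧸ I) := Ideal.Quotient.nontrivial_iff.mpr hprimary.1
  have hlocal : IsLocalRing (R ⧸ I) :=
    .of_surjective' (Ideal.Quotient.mk I) Ideal.Quotient.mk_surjective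
  have hloc : IsLocalHom (Ideal.Quotient.mk I) := .of_surjective _ Ideal.Quotient.mk_surjective
  have hnil : IsNilpotent (maximalIdeal (R ⧸ I)) := by
    rw [Ideal.FG.isNilpotent_iff_le_nilradical (IsNoetherian.noetherian _)]
    intro r hr
    obtain ⟨r, rfl⟩ := Ideal.Quotient.mk_surjective r
    have hrm : r ∈ I.radical := by
      rw [hradical]
      exact fun h => hr (h.map _)
    obtain ⟨n, hn⟩ := hrm
    exact ⟨n, by rw [← map_pow, Ideal.Quotient.eq_zero_iff_mem.mpr hn]; exact zero_mem _⟩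
  have hdim : ringKrullDim (R ⧸ I) = 0 := by
    rw [← ringKrullDimZero_iff_ringKrullDim_eq_zero, ← isArtinianRing_iff_krullDimLE_zero]
    exact (isArtinianRing_iff_isNilpotent_maximalIdeal _).mpr hnil
  obtain ⟨a, ha, b, hb, hab⟩ : ∃ a ∈ maximalIdeal R,
      ∃ b ∈ I.colon (maximalIdeal R : Set R), a * b ∉ maximalIdeal R * I := by
    by_contra! h
    exact hburch (le_antisymm (Ideal.mul_mono_right Ideal.le_colon) (Ideal.mul_le.mpr h))
  refine ⟨hlocal, ?_, fun K _ _ hK C _ _ hC => ?_⟩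
  · obtain ⟨E, _, _, x, _, _, hx⟩ := exists_injective_isSimpleSocleGenerator hnil
    exact ⟨E, inferInstance, inferInstance, isCanonicalModule_of_injective hdim E hx⟩
  have := hC.finite
  obtain ⟨n, p, hp, hpm⟩ := exists_minimal_free_cover (A := R ⧸ I) C
  by_cases hker : LinearMap.ker p = ⊥
  · exact .inl (nonempty_linearEquiv_of_free
      (LinearEquiv.ofBijective p ⟨LinearMap.ker_eq_bot.mp hker, hp⟩) hC.bijective_homothety)
  right
  have : Nontrivial (LinearMap.ker p) := Submodule.nontrivial_iff_ne_bot.mpr hker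
  -- The syzygy `ker p` lies in `𝔪 A ^ n`, so it is killed by the socle element `b` of `A = R / I`.
  have hbker : ∀ v : LinearMap.ker p, Ideal.Quotient.mk I b • v = 0 := by
    intro v
    ext i
    obtain ⟨r, hr⟩ := Ideal.Quotient.mk_surjective ((v : Fin n → R ⧸ I) i)
    have hrm : r ∈ maximalIdeal R := fun h => hpm _ v.2 i (hr ▸ h.map _)
    change Ideal.Quotient.mk I b * (v : Fin n → R ⧸ I) i = 0
    rw [← hr, ← map_mul, Ideal.Quotient.eq_zero_iff_mem]
    exact Submodule.mem_colon.mp hb r hrm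
  have hCinj : Module.Injective (R ⧸ I) C := injective_of_forall_exists_eq_smul hnil C
    (exists_eq_smul_of_subsingleton_ext ha hb hab (LinearMap.ker p) C hbker
      (subsingleton_ext_ker p hp hC.subsingleton_ext))
  have hKinj := hK.injective hnil hdim
  obtain ⟨x, hx⟩ := hK.exists_isSimpleSocleGenerator hdim
  exact nonempty_linearEquiv_of_injective hnil hx hC.bijective_homothety
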